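/- Let $S$ be a semitopological semigroup, i.e. a semigroup with a topology for which all left translations $l_s:t\mapsto st$ and all right translations $t\mapsto ts$ are continuous. Let $C(S)$ be the $C^*$-algebra of bounded continuous functions $S\to\mathbb C$ with the supremum norm, and put $L_sf=f\circ l_s$. Let $LMC(S)$ be the set of all $f\in C(S)$ such that $s\mapsto\mu(L_sf)$ is continuous on $S$ for every $\mu$ in the spectrum of $C(S)$; it is a left translation invariant unital $C^*$-subalgebra of $C(S)$, with spectrum $S^{LMC}$. For $\mu\in S^{LMC}$ and $f\in LMC(S)$ put $(T_\mu f)(s)=\mu(L_sf)$, and let $\Sigma=\{T_\mu:\mu\in S^{LMC}\}$. Let $F_0$ be the set of constant functions on $S$ of modulus $1$ and, for $k\ge 1$, let $$F_k=\{f\in LMC(S): |f|=1 \text{ and for every } \sigma\in\Sigma \text{ there is } f_\sigma\in F_{k-1} \text{ with } \sigma(f)=f_\sigma f\}.$$ Let $W_k(S)$ be the norm closure in $C(S)$ of the algebra generated by $F_k$. Let $SAP(S)$, the space of strongly almost periodic functions, be the closed linear span in $C(S)$ of the coefficients $s\mapsto\langle U_s\xi,\eta\rangle$ of all continuous finite-dimensional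 unitary representations $U$ of $S$. (i) For every abelian semitopological semigroup $S$ and every integer $k\ge 1$, $SAP(S)\subseteq W_k(S)$. (ii) For every abelian semitopological semigroup $S$ with a left identity, $W_1(S)=SAP(S)$. -/

import Mathlib

open scoped BoundedContinuousFunction

namespace WeylAlgebra

noncomputable section

/-- The left translation `l_s : t ↦ s * t` of a semitopological semigroup (a semigroup in which
all left and right translations are continuous), as a continuous map. -/
def leftMul {S : Type*} [Semigroup S] [TopologicalSpace S] [SeparatelyContinuousMul S] (s : S) :
    C(S, S) :=
  ⟨fun t => s * t, continuous_const_mul s⟩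

/-- The left translate `L_s f = f ∘ l_s` of `f ∈ C(S)`. -/
def leftTranslate {S : Type*} [Semigroup S] [TopologicalSpace S] [SeparatelyContinuousMul S]
    (s : S) (f : S →ᵇ ℂ) : S →ᵇ ℂ :=
  f.compContinuous (leftMul s)

/-- `LMC(S)`, the left multiplicatively continuous functions: those `f ∈ C(S)` for which
`s ↦ μ (L_s f)` is continuous for every `μ` in the spectrum of `C(S)`
(boundedness of `s ↦ μ (L_s f)` is automatic). It is a unital `C⋆`-subalgebra of `C(S)`. -/
def LMC (S : Type*) [Semigroup S] [TopologicalSpace S] [SeparatelyContinuousMul S] :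
    StarSubalgebra ℂ (S →ᵇ ℂ) where
  carrier := {f | ∀ μ : WeakDual.characterSpace ℂ (S →ᵇ ℂ),
    Continuous fun s : S => μ (leftTranslate s f)}
  mul_mem' {f g} hf hg μ := by
    have h : (fun s : S => μ (leftTranslate s (f * g))) =
        fun s => μ (leftTranslate s f) * μ (leftTranslate s g) := by
      funext s
      rw [← map_mul]
      rfl
    rw [h]
    exact (hf μ).mul (hg μ)
  add_mem' {f g} hf hg μ := by
    have h : (fun s : S => μ (leftTranslate s (f + g))) =
        fun s => μ (leftTranslate s f) + μ (leftTranslate s g) := by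
      funext s
      rw [← map_add]
      rfl
    rw [h]
    exact (hf μ).add (hg μ)
  algebraMap_mem' c μ := by
    have h : (fun s : S => μ (leftTranslate s (algebraMap ℂ (S →ᵇ ℂ) c))) =
        fun _ => μ (algebraMap ℂ (S →ᵇ ℂ) c) := by
      funext s
      rfl
    rw [h]
    exact continuous_const
  star_mem' {f} hf μ := by
    have h : (fun s : S => μ (leftTranslate s (star f))) =
        fun s => star (μ (leftTranslate s f)) := by
      funext s
      rw [← map_star]
      rfl
    rw [h]
    exact (hf μ).star

/-- `LMC(S)` is left translation invariant. -/
theorem leftTranslate_mem_LMC {S : Type*} [Semigroup S] [TopologicalSpace S]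
    [SeparatelyContinuousMul S] (s : S) {f : S →ᵇ ℂ} (hf : f ∈ LMC S) :
    leftTranslate s f ∈ LMC S := by
  intro μ
  have h : (fun t : S => μ (leftTranslate t (leftTranslate s f))) =
      fun t => μ (leftTranslate (s * t) f) := by
    funext t
    congr 1
    ext x
    exact congrArg f (mul_assoc s t x).symm
  rw [h]
  exact (hf μ).comp (continuous_const_mul s)

/-- For `μ ∈ S^LMC`, the spectrum of the algebra `LMC(S)`, and `f ∈ LMC(S)`, the function
`T_μ f : s ↦ μ (L_s f)`. The set `Σ` consists of the operators `T_μ`, `μ ∈ S^LMC`. -/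
def T {S : Type*} [Semigroup S] [TopologicalSpace S] [SeparatelyContinuousMul S]
    (μ : WeakDual.characterSpace ℂ (LMC S)) (f : LMC S) : S → ℂ :=
  fun s => μ ⟨leftTranslate s (f : S →ᵇ ℂ), leftTranslate_mem_LMC s f.2⟩

/-- The sets `F_k`: `F_0` is the set of constant functions of modulus one, and `F_(k+1)` is the set
of `f ∈ LMC(S)` of modulus one such that for every `σ = T_μ ∈ Σ` there is `f_σ ∈ F_k` with
`σ(f) = f_σ f`. -/
def F (S : Type*) [Semigroup S] [TopologicalSpace S] [SeparatelyContinuousMul S] :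
    ℕ → Set (S →ᵇ ℂ)
  | 0 => {f | ∃ c : ℂ, ‖c‖ = 1 ∧ f = BoundedContinuousFunction.const S c}
  | k + 1 => {f | ∃ hf : f ∈ LMC S, (∀ s, ‖f s‖ = 1) ∧
      ∀ μ : WeakDual.characterSpace ℂ (LMC S), ∃ g ∈ F S k, ∀ s, T μ ⟨f, hf⟩ s = g s * f s}

/-- `W_k(S)`: the norm closure in `C(S)` of the algebra generated by `F_k`. (As `F_k` contains the
constant function `1`, the generated algebra is the generated unital algebra.) -/
def W (S : Type*) [Semigroup S] [TopologicalSpace S] [SeparatelyContinuousMul S] (k : ℕ) :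
    Subalgebra ℂ (S →ᵇ ℂ) :=
  (Algebra.adjoin ℂ (F S k)).topologicalClosure

/-- `f` is a coefficient of a continuous finite dimensional unitary representation of `S`:
`f(s) = ⟨U(s) ξ, η⟩` for a continuous homomorphism `U` into some unitary group `U(n)` and vectors
`ξ, η ∈ ℂⁿ`. -/
def IsUnitaryCoefficient {S : Type*} [Semigroup S] [TopologicalSpace S] (f : S →ᵇ ℂ) : Prop :=
  ∃ (n : ℕ) (U : S →ₙ* Matrix.unitaryGroup (Fin n) ℂ) (ξ η : Fin n → ℂ), Continuous U ∧
    ∀ s, f s = dotProduct (star η) (Matrix.mulVec (U s : Matrix (Fin n) (Fin n) ℂ) ξ)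

/-- `SAP(S)`, the strongly almost periodic functions: the closed linear span in `C(S)` of the
coefficients of the continuous finite dimensional unitary representations of `S`. -/
def SAP (S : Type*) [Semigroup S] [TopologicalSpace S] : Submodule ℂ (S →ᵇ ℂ) :=
  (Submodule.span ℂ {f : S →ᵇ ℂ | IsUnitaryCoefficient f}).topologicalClosure

end

end WeylAlgebra

/-! On an abelian semigroup both algebras reduce to unimodular characters. Commuting unitary
matrices have a spanning set of joint eigenvectors, and the eigenvalues along each one form a
continuous character, so `SAP S` is the closed span of the characters
(`SAP_eq_topologicalClosure_span`). A character `f` satisfies `L_s f = f(s) f`, hence `T_μ f = μ(f)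
f` with `|μ(f)| = 1`; it lies in `F S 1`, and the `F S k` increase, which gives (i). For (ii), point
evaluations and a left identity `e` show that `f / f(e)` is a character for each `f` in `F S 1`. -/

namespace WeylAlgebra

open Module.End

/-! ### Joint diagonalization of commuting unitary matrices -/

section Matrix

open scoped ComplexOrder

variable {n : Type*} [Fintype n]

/-- A vector annihilated by the square of a normal matrix is annihilated by the matrix. -/
theorem mulVec_eq_zero_of_normal [DecidableEq n] {N : Matrix n n ℂ}
    (hN : N.conjTranspose * N = N * N.conjTranspose) {v : n → ℂ}
    (hv : N.mulVec (N.mulVec v) = 0) : N.mulVec v = 0 := by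
  rw [← Matrix.conjTranspose_mul_self_mulVec_eq_zero,
    ← Matrix.conjTranspose_mul_self_mulVec_eq_zero]
  have h : (N.conjTranspose * N).conjTranspose * (N.conjTranspose * N) =
      N.conjTranspose * N.conjTranspose * (N * N) := by
    rw [Matrix.conjTranspose_mul, Matrix.conjTranspose_conjTranspose]
    calc N.conjTranspose * N * (N.conjTranspose * N)
        = N.conjTranspose * (N * N.conjTranspose) * N := by simp only [mul_assoc]
      _ = N.conjTranspose * N.conjTranspose * (N * N) := by rw [← hN]; simp only [mul_assoc]
  rw [h, ← Matrix.mulVec_mulVec, ← Matrix.mulVec_mulVec v N N, hv, Matrix.mulVec_zero]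

theorem maxGenEigenspace_mulVecLin_of_mem_unitaryGroup [DecidableEq n] {u : Matrix n n ℂ}
    (hu : u ∈ Matrix.unitaryGroup n ℂ) (c : ℂ) :
    maxGenEigenspace u.mulVecLin c = eigenspace u.mulVecLin c := by
  refine le_antisymm (fun v hv => ?_) eigenspace_le_maxGenEigenspace
  have hsub (w : n → ℂ) : (u.mulVecLin - algebraMap ℂ _ c) w = (u - c • 1).mulVec w := by
    simp [Matrix.sub_mulVec, Matrix.smul_mulVec]
  have hnormal : (u - c • 1).conjTranspose * (u - c • 1) =
      (u - c • 1) * (u - c • 1).conjTranspose := by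
    have h1 : u.conjTranspose * u = 1 := Matrix.mem_unitaryGroup_iff'.1 hu
    have h2 : u * u.conjTranspose = 1 := Matrix.mem_unitaryGroup_iff.1 hu
    simp only [Matrix.conjTranspose_sub, Matrix.conjTranspose_smul, Matrix.conjTranspose_one,
      sub_mul, mul_sub, h1, h2, smul_mul_assoc, mul_smul_comm, mul_one, one_mul]
    rw [smul_sub, smul_sub, smul_comm c (star c)]
    abel
  rw [mem_maxGenEigenspace] at hv
  obtain ⟨k, hk⟩ := hv
  rw [mem_eigenspace_iff, ← sub_eq_zero]
  suffices (u - c • 1).mulVec v = 0 by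
    simpa [Matrix.sub_mulVec, Matrix.smul_mulVec] using this
  -- With `N = u - c`, the inductive hypothesis applied to `N w` gives `N (N w) = 0`, and normality
  -- of `N` removes one factor.
  have key : ∀ (k : ℕ) (w : n → ℂ), ((u.mulVecLin - c • (1 : Module.End ℂ (n → ℂ))) ^ k) w = 0 →
      (u - c • 1).mulVec w = 0 := by
    intro k
    induction k with
    | zero =>
      intro w hw
      have : w = 0 := by simpa using hw
      rw [this, Matrix.mulVec_zero]
    | succ k ih =>
      intro w hw
      rw [pow_succ] at hw
      have := ih _ hw
      apply mulVec_eq_zero_of_normal hnormal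
      rw [← this]
      congr 1
      exact (hsub w).symm
  exact key k v hk

/-- Commuting unitary matrices have a spanning set of joint eigenvectors. -/
theorem iSup_iInf_eigenspace_mulVecLin_eq_top [DecidableEq n] {ι : Type*}
    (u : ι → Matrix.unitaryGroup n ℂ) (hu : ∀ i j, Commute (u i) (u j)) :
    ⨆ χ : ι → ℂ, ⨅ i, eigenspace (u i : Matrix n n ℂ).mulVecLin (χ i) = ⊤ := by
  have h := iSup_iInf_maxGenEigenspace_eq_top_of_iSup_maxGenEigenspace_eq_top_of_commute
    (fun i => (u i : Matrix n n ℂ).mulVecLin)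
    (fun i j _ => by
      change _ * _ = _ * _
      rw [Module.End.mul_eq_comp, Module.End.mul_eq_comp, ← Matrix.mulVecLin_mul,
        ← Matrix.mulVecLin_mul]
      exact congrArg (fun w : Matrix.unitaryGroup n ℂ => (w : Matrix n n ℂ).mulVecLin) (hu i j))
    (fun i => iSup_maxGenEigenspace_eq_top _)
  simpa only [maxGenEigenspace_mulVecLin_of_mem_unitaryGroup (u _).2] using h

theorem norm_eq_one_of_mulVec_eq_smul {n : ℕ} {u : Matrix (Fin n) (Fin n) ℂ}
    (hu : u ∈ Matrix.unitaryGroup (Fin n) ℂ) {v : Fin n → ℂ} (hv : v ≠ 0) {c : ℂ}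
    (h : u.mulVec v = c • v) : ‖c‖ = 1 := by
  have h1 : dotProduct (star (u.mulVec v)) (u.mulVec v) = dotProduct (star v) v := by
    rw [Matrix.star_mulVec, Matrix.dotProduct_mulVec, Matrix.vecMul_vecMul,
      ← Matrix.star_eq_conjTranspose, Matrix.mem_unitaryGroup_iff'.1 hu, Matrix.vecMul_one]
  rw [h, star_smul, smul_dotProduct, dotProduct_smul, smul_smul, smul_eq_mul] at h1
  have h2 : dotProduct (star v) v ≠ 0 := by
    rwa [Ne, dotProduct_star_self_eq_zero]
  have h3 : star c * c = 1 := mul_right_cancel₀ h2 (by rw [h1, one_mul])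
  have h4 : ‖c‖ * ‖c‖ = 1 := by simpa using congrArg norm h3
  nlinarith [norm_nonneg c]

end Matrix

/-! ### Unitary coefficients and characters -/

section Characters

variable {S : Type*} [TopologicalSpace S]

/-- A continuous character of `S`: a multiplicative function with values in the unit circle. -/
structure IsUnimodularCharacter [Mul S] (f : S →ᵇ ℂ) : Prop where
  map_mul : ∀ s t, f (s * t) = f s * f t
  norm_eq_one : ∀ s, ‖f s‖ = 1

theorem IsUnimodularCharacter.isUnitaryCoefficient [Semigroup S] {f : S →ᵇ ℂ}
    (hf : IsUnimodularCharacter f) : IsUnitaryCoefficient f := by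
  have hmem (s : S) : Matrix.of (fun _ _ : Fin 1 => f s) ∈ Matrix.unitaryGroup (Fin 1) ℂ := by
    rw [Matrix.mem_unitaryGroup_iff]
    ext i j
    fin_cases i
    fin_cases j
    simp [Matrix.mul_apply, Matrix.star_apply, Complex.mul_conj', hf.norm_eq_one s]
  refine ⟨1, ⟨fun s => ⟨_, hmem s⟩, fun s t => ?_⟩, 1, 1, ?_, fun s => ?_⟩
  · ext i j
    simp [Matrix.mul_apply, hf.map_mul]
  · refine Continuous.subtype_mk ?_ _
    exact continuous_matrix fun _ _ => f.continuous
  · simp [dotProduct, Matrix.mulVec]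

theorem IsUnitaryCoefficient.mem_span [CommSemigroup S] {f : S →ᵇ ℂ}
    (hf : IsUnitaryCoefficient f) :
    f ∈ Submodule.span ℂ {g : S →ᵇ ℂ | IsUnimodularCharacter g} := by
  obtain ⟨n, U, ξ, η, hU, hf⟩ := hf
  suffices ∃ g ∈ Submodule.span ℂ {g : S →ᵇ ℂ | IsUnimodularCharacter g},
      ∀ s, g s = dotProduct (star η) (Matrix.mulVec (U s : Matrix (Fin n) (Fin n) ℂ) ξ) by
    obtain ⟨g, hg, h⟩ := this
    rwa [show f = g from BoundedContinuousFunction.ext fun s => (hf s).trans (h s).symm]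
  have hξ : ξ ∈ ⨆ χ : S → ℂ, ⨅ s,
      eigenspace (U s : Matrix (Fin n) (Fin n) ℂ).mulVecLin (χ s) := by
    rw [iSup_iInf_eigenspace_mulVecLin_eq_top _ fun s t => ?_]
    · trivial
    · rw [Commute, SemiconjBy, ← map_mul, ← map_mul, mul_comm]
  clear hf
  induction hξ using Submodule.iSup_induction' with
  | zero => exact ⟨0, zero_mem _, fun s => by simp⟩
  | add x y _ _ hx hy =>
    obtain ⟨g, hg, hg'⟩ := hx
    obtain ⟨h, hh, hh'⟩ := hy
    exact ⟨g + h, add_mem hg hh, fun s => by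
      rw [BoundedContinuousFunction.add_apply, hg', hh', Matrix.mulVec_add, dotProduct_add]⟩
  | mem χ v hv =>
    -- For `v = 0` the family `χ` is arbitrary and need not be a character.
    by_cases hv0 : v = 0
    · exact ⟨0, zero_mem _, fun s => by simp [hv0]⟩
    have hχ (s : S) : (U s : Matrix (Fin n) (Fin n) ℂ).mulVec v = χ s • v :=
      mem_eigenspace_iff.1 ((Submodule.mem_iInf _).1 hv s)
    obtain ⟨i, hi⟩ := Function.ne_iff.1 hv0
    -- Reading `χ` off a nonzero coordinate of `v` makes its continuity follow from that of `U`.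
    have hχi (s : S) : χ s = (U s : Matrix (Fin n) (Fin n) ℂ).mulVec v i / v i := by
      rw [hχ, Pi.smul_apply, smul_eq_mul, mul_div_cancel_right₀ _ hi]
    have hcont : Continuous χ := by
      rw [funext hχi]
      exact ((continuous_apply i).comp
        ((continuous_subtype_val.comp hU).matrix_mulVec continuous_const)).div_const _
    have hnorm (s : S) : ‖χ s‖ = 1 := norm_eq_one_of_mulVec_eq_smul (U s).2 hv0 (hχ s)
    let g : S →ᵇ ℂ := .ofNormedAddCommGroup χ hcont 1 fun s => (hnorm s).le
    have hg : IsUnimodularCharacter g := by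
      refine ⟨fun s t => ?_, hnorm⟩
      have h : χ (s * t) • v = (χ s * χ t) • v := by
        rw [← hχ, map_mul, Submonoid.coe_mul, ← Matrix.mulVec_mulVec, hχ, Matrix.mulVec_smul, hχ,
          smul_smul, mul_comm]
      exact smul_left_injective ℂ hv0 h
    refine ⟨dotProduct (star η) v • g, Submodule.smul_mem _ _ (Submodule.subset_span hg),
      fun s => ?_⟩
    rw [hχ, dotProduct_smul, BoundedContinuousFunction.smul_apply, smul_eq_mul, smul_eq_mul,
      mul_comm]
    rfl

/-- On an abelian semigroup, `SAP(S)` is the closed linear span of the characters. -/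
theorem SAP_eq_topologicalClosure_span [CommSemigroup S] :
    SAP S = (Submodule.span ℂ {g : S →ᵇ ℂ | IsUnimodularCharacter g}).topologicalClosure := by
  rw [SAP]
  congr 1
  exact le_antisymm (Submodule.span_le.2 fun _ hf => IsUnitaryCoefficient.mem_span hf)
    (Submodule.span_mono fun _ hf => IsUnimodularCharacter.isUnitaryCoefficient hf)

end Characters

/-! ### Characters inside `F S 1`, and the converse -/

section LMC

variable {S : Type*} [TopologicalSpace S]

/-- A bounded multiplicative functional does not expand the norm of an element whose powers have
norm at most one. -/
theorem norm_map_le_one_of_norm_pow_le {A : Type*} [NormedRing A] [NormedAlgebra ℂ A]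
    (μ : WeakDual.characterSpace ℂ A) {a : A} (ha : ∀ n : ℕ, ‖a ^ n‖ ≤ 1) : ‖μ a‖ ≤ 1 := by
  by_contra! h
  obtain ⟨m, hm⟩ := pow_unbounded_of_one_lt ‖WeakDual.toStrongDual (μ : WeakDual ℂ A)‖ h
  refine hm.not_ge ?_
  rw [← norm_pow, ← map_pow]
  calc ‖μ (a ^ m)‖ ≤ ‖WeakDual.toStrongDual (μ : WeakDual ℂ A)‖ * ‖a ^ m‖ :=
        (WeakDual.toStrongDual (μ : WeakDual ℂ A)).le_opNorm _
    _ ≤ ‖WeakDual.toStrongDual (μ : WeakDual ℂ A)‖ :=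
        mul_le_of_le_one_right (norm_nonneg _) (ha m)

/-- Both `f` and its inverse `star f` have powers of norm at most one, so `μ` sends each into the
closed unit disc. The power argument spares assuming `A` closed. -/
theorem norm_map_eq_one_of_unimodular {A : StarSubalgebra ℂ (S →ᵇ ℂ)}
    (μ : WeakDual.characterSpace ℂ A) (f : A) (hf : ∀ s, ‖(f : S →ᵇ ℂ) s‖ = 1) : ‖μ f‖ = 1 := by
  have key (g : A) (hg : ∀ s, ‖(g : S →ᵇ ℂ) s‖ = 1) : ‖μ g‖ ≤ 1 := by
    refine norm_map_le_one_of_norm_pow_le μ fun n => ?_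
    refine (BoundedContinuousFunction.norm_le zero_le_one).2 fun s => ?_
    change ‖((g : S →ᵇ ℂ) ^ n) s‖ ≤ 1
    rw [BoundedContinuousFunction.pow_apply, norm_pow, hg, one_pow]
  have hstar : f * star f = 1 := by
    ext s
    simp [Complex.mul_conj', hf s]
  have h1 : ‖μ f‖ * ‖μ (star f)‖ = 1 := by
    rw [← norm_mul, ← map_mul, hstar, map_one, norm_one]
  have h2 := key f hf
  have h3 := key (star f) fun s => by simpa using hf s
  nlinarith [norm_nonneg (μ f), norm_nonneg (μ (star f))]

variable [CommSemigroup S] [SeparatelyContinuousMul S]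

theorem IsUnimodularCharacter.leftTranslate_eq {f : S →ᵇ ℂ} (hf : IsUnimodularCharacter f)
    (s : S) : leftTranslate s f = f s • f :=
  BoundedContinuousFunction.ext fun t => hf.map_mul s t

theorem IsUnimodularCharacter.mem_LMC {f : S →ᵇ ℂ} (hf : IsUnimodularCharacter f) :
    f ∈ LMC S := by
  intro μ
  simp only [hf.leftTranslate_eq, map_smul]
  exact f.continuous.smul continuous_const

theorem IsUnimodularCharacter.mem_F {f : S →ᵇ ℂ} (hf : IsUnimodularCharacter f) : f ∈ F S 1 := by
  refine ⟨hf.mem_LMC, hf.norm_eq_one, fun μ => ⟨_, ⟨μ ⟨f, hf.mem_LMC⟩, ?_, rfl⟩, fun s => ?_⟩⟩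
  · exact norm_map_eq_one_of_unimodular μ _ hf.norm_eq_one
  · have h : (⟨leftTranslate s f, leftTranslate_mem_LMC s hf.mem_LMC⟩ : LMC S) =
        f s • ⟨f, hf.mem_LMC⟩ := Subtype.ext (hf.leftTranslate_eq s)
    rw [T]
    simp only [h, map_smul]
    exact mul_comm _ _

theorem F_zero_subset_F_one : F S 0 ⊆ F S 1 := by
  rintro _ ⟨c, hc, rfl⟩
  have hmem : BoundedContinuousFunction.const S c ∈ LMC S := (LMC S).algebraMap_mem c
  refine ⟨hmem, fun _ => hc, fun μ =>
    ⟨_, ⟨1, norm_one, rfl⟩, fun s => ?_⟩⟩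
  have h : (⟨leftTranslate s (BoundedContinuousFunction.const S c),
      leftTranslate_mem_LMC s hmem⟩ : LMC S) = algebraMap ℂ (LMC S) c := rfl
  rw [T]
  simp only [h, AlgHomClass.commutes]
  simp

theorem F_subset_F_succ (k : ℕ) : F S k ⊆ F S (k + 1) := by
  induction k with
  | zero => exact F_zero_subset_F_one
  | succ k ih =>
    rintro f ⟨hf, h1, h⟩
    refine ⟨hf, h1, fun μ => ?_⟩
    obtain ⟨g, hg, hg'⟩ := h μ
    exact ⟨g, ih hg, hg'⟩

theorem monotone_F : Monotone (F S) := monotone_nat_of_le_succ F_subset_F_succ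

theorem SAP_subset_W {k : ℕ} (hk : 1 ≤ k) : (SAP S : Set (S →ᵇ ℂ)) ⊆ W S k := by
  rw [SAP_eq_topologicalClosure_span]
  refine closure_mono ?_
  have h : Submodule.span ℂ {g : S →ᵇ ℂ | IsUnimodularCharacter g} ≤
      Subalgebra.toSubmodule (Algebra.adjoin ℂ (F S k)) :=
    Submodule.span_le.2 fun f hf => Algebra.subset_adjoin (monotone_F hk hf.mem_F)
  exact h

/-- The evaluation at a point of `S`, as a character of a subalgebra of `C(S)`. -/
noncomputable def evalCharacter (A : StarSubalgebra ℂ (S →ᵇ ℂ)) (s : S) :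
    WeakDual.characterSpace ℂ A :=
  ⟨(BoundedContinuousFunction.evalCLM ℂ s).comp A.toSubalgebra.toSubmodule.subtypeL, by
    rw [WeakDual.CharacterSpace.eq_set_map_one_map_mul]
    exact ⟨rfl, fun _ _ => rfl⟩⟩

/-- If `S` has an identity, the elements of `F_1` are multiples of characters. -/
theorem exists_eq_smul_of_mem_F_one {e : S} (he : ∀ s, e * s = s) {f : S →ᵇ ℂ} (hf : f ∈ F S 1) :
    ∃ (c : ℂ) (g : S →ᵇ ℂ), IsUnimodularCharacter g ∧ f = c • g := by
  obtain ⟨hL, h1, h⟩ := hf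
  have he0 : f e ≠ 0 := by
    rw [← norm_ne_zero_iff, h1]
    exact one_ne_zero
  -- Taking `μ` to be evaluation at `s` gives `f (t * s) = c * f t` for all `t`; putting `t = e`
  -- identifies `c` as `f s / f e`.
  have key (s t : S) : f (t * s) * f e = f s * f t := by
    obtain ⟨_, ⟨c, -, rfl⟩, hc⟩ := h (evalCharacter _ s)
    have hc' (t : S) : f (t * s) = c * f t := hc t
    have h2 := hc' e
    rw [he] at h2
    rw [hc', h2]
    ring
  refine ⟨f e, (f e)⁻¹ • f, ⟨fun s t => ?_, fun s => ?_⟩, ?_⟩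
  · simp only [BoundedContinuousFunction.smul_apply, smul_eq_mul]
    have := key t s
    field_simp
    rw [mul_comm, this, mul_comm]
  · simp [h1]
  · rw [smul_smul, mul_inv_cancel₀ he0, one_smul]

theorem W_one_subset_SAP {e : S} (he : ∀ s, e * s = s) : (W S 1 : Set (S →ᵇ ℂ)) ⊆ SAP S := by
  rw [SAP_eq_topologicalClosure_span]
  refine closure_mono ?_
  suffices Subalgebra.toSubmodule (Algebra.adjoin ℂ (F S 1)) ≤
      Submodule.span ℂ {g : S →ᵇ ℂ | IsUnimodularCharacter g} from this
  rw [Algebra.adjoin_eq_span, Submodule.span_le]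
  -- Scalar multiples of characters are closed under products, so the generated algebra needs only
  -- linear combinations of characters.
  suffices ∀ f ∈ Submonoid.closure (F S 1),
      ∃ (c : ℂ) (g : S →ᵇ ℂ), IsUnimodularCharacter g ∧ f = c • g by
    intro f hf
    obtain ⟨c, g, hg, rfl⟩ := this f hf
    exact Submodule.smul_mem _ _ (Submodule.subset_span hg)
  intro f hf
  induction hf using Submonoid.closure_induction with
  | mem f hf => exact exists_eq_smul_of_mem_F_one he hf
  | one => exact ⟨1, 1, ⟨fun _ _ => by simp, fun _ => by simp⟩, by simp⟩
  | mul f₁ f₂ _ _ h₁ h₂ =>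
    obtain ⟨c₁, g₁, hg₁, rfl⟩ := h₁
    obtain ⟨c₂, g₂, hg₂, rfl⟩ := h₂
    refine ⟨c₁ * c₂, g₁ * g₂, ⟨fun s t => ?_, fun s => ?_⟩, smul_mul_smul_comm _ _ _ _⟩
    · simp only [BoundedContinuousFunction.mul_apply, hg₁.map_mul, hg₂.map_mul]
      ring
    · simp [hg₁.norm_eq_one, hg₂.norm_eq_one]

end LMC

end WeylAlgebra

theorem proposition3p7 :
    (∀ (S : Type*) [CommSemigroup S] [TopologicalSpace S] [SeparatelyContinuousMul S] (k : ℕ),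
      1 ≤ k → (WeylAlgebra.SAP S : Set (S →ᵇ ℂ)) ⊆ (WeylAlgebra.W S k : Set (S →ᵇ ℂ))) ∧
    (∀ (S : Type*) [CommSemigroup S] [TopologicalSpace S] [SeparatelyContinuousMul S],
      (∃ e : S, ∀ s : S, e * s = s) →
        (WeylAlgebra.W S 1 : Set (S →ᵇ ℂ)) = (WeylAlgebra.SAP S : Set (S →ᵇ ℂ))) :=
  ⟨fun _ _ _ _ _ hk => WeylAlgebra.SAP_subset_W hk,
    fun _ _ _ _ ⟨_, he⟩ =>
      (WeylAlgebra.W_one_subset_SAP he).antisymm (WeylAlgebra.SAP_subset_W le_rfl)⟩
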